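/- Let $\alpha>-1$ be real. Write $(c)_k=c(c+1)\cdots(c+k-1)$, $(c)_0=1$, $\binom{c}{k}=\frac{c(c-1)\cdots(c-k+1)}{k!}$, and $${}_pF_q(c_1,\dots,c_p;d_1,\dots,d_q;z)=\sum_{k=0}^\infty\frac{(c_1)_k\cdots(c_p)_k}{(d_1)_k\cdots(d_q)_k\,k!}z^k .$$ For $i\ge1$ let $$a_i(x)=\frac1{i!}\sum_{j=1}^i(-1)^{i+j+1}\binom{\alpha+1}{j-1}\binom{\alpha+2}{i-j}(\alpha+3)_{i-j}\,x^j .$$ Let $\beta_1(x)=0$ and, for $i\ge2$, $\beta_i(x)=\beta_i^{(1)}(x)+\beta_i^{(2)}(x)+\beta_i^{(3)}(x)+\beta_i^{(4)}(x)$, where $$\beta_i^{(1)}(x)=\frac{1}{(\alpha+1)(i-2)!}\sum_{j=1}^i(-1)^{i+j+1}\binom{\alpha+2}{j-1}\binom{\alpha+3}{i-j}(\alpha+2)_{i-j}\,x^{j-1},$$ $$\beta_i^{(2)}(x)=\frac{2(\alpha+2)}{(\alpha+1)(i-1)!}\sum_{j=2}^i(-1)^{i+j+1}\binom{\alpha+1}{j-2}\binom{\alpha+2}{i-j}(\alpha+3)_{i-j}\,x^{j-2},$$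 $$\beta_i^{(3)}(x)=\frac{1}{(\alpha+1)^2(\alpha+2)(\alpha+3)^2(i-2)!}\sum_{j=0}^i(-1)^{i+j+1}\binom{\alpha+3}{j}\binom{\alpha+3}{i-j}(\alpha+1)_{i-j}\bigl[(\alpha+1)(\alpha+3)+j(i-j)\bigr]x^j,$$ $$\beta_i^{(4)}(x)=\frac{i-2}{(\alpha+1)^2(\alpha+3)(\alpha+4)^2(i-2)!}\sum_{j=0}^i(-1)^{i+j+1}\binom{\alpha+4}{j}\binom{\alpha+4}{i-j}(\alpha+1)_{i-j}\bigl[(\alpha+1)(\alpha+4)+j(i-j)\bigr]x^j.$$ Then for every complex $x$ the series $\sum_{i\ge1}a_i(x)$ and $\sum_{i\ge1}\beta_i(x)$ converge absolutely, and $$\sum_{i=1}^\infty a_i(x)=-\frac{\sin\pi\alpha}{\pi}\,\frac{x}{(\alpha+2)(\alpha+3)}\;{}_1F_1(1;\alpha+4;-x),$$ $$\sum_{i=1}^\infty\beta_i(x)=\frac{\sin\pi\alpha}{\pi}\,\frac{\alpha+2}{(\alpha+1)(\alpha+3)(\alpha+4)}\Bigl[1-x\;{}_2F_2(1,\alpha+3;\alpha+2,\alpha+5;-x)\Bigr].$$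 In particular, if $\alpha$ is a nonnegative integer, both sums vanish, and moreover $\sum_{i=1}^{2\alpha+4}a_i(x)=0$ and $\sum_{i=1}^{2\alpha+8}\beta_i(x)=0$. -/

import Mathlib

open scoped Nat

namespace SobolevLaguerre

/-- The Pochhammer symbol (rising factorial) `(a)_k = a (a + 1) ⋯ (a + k - 1)`, `(a)_0 = 1`. -/
noncomputable def poch {R : Type*} [CommRing R] (a : R) (k : ℕ) : R :=
  (ascPochhammer R k).eval a

/-- The (unregularized) generalized hypergeometric series `pFq(a; b; z)`, with numerator
parameters `a` and denominator parameters `b`. -/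
noncomputable def pFq (a b : Multiset ℂ) (z : ℂ) : ℂ :=
  ∑' k : ℕ, (a.map fun t => poch t k).prod / ((b.map fun t => poch t k).prod * (k ! : ℂ)) * z ^ k

/-- The polynomial `a_i(x)`, `i ≥ 1`. The generalized binomial coefficient `α + 1` over `k` is
`Ring.choose (α + 1) k`. -/
noncomputable def aCoeff (α : ℝ) (i : ℕ) (x : ℂ) : ℂ :=
  ((1 / (i ! : ℝ) : ℝ) : ℂ) *
    ∑ j ∈ Finset.Icc 1 i,
      (((-1) ^ (i + j + 1) * Ring.choose (α + 1) (j - 1) * Ring.choose (α + 2) (i - j) *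
        poch (α + 3) (i - j) : ℝ) : ℂ) * x ^ j

/-- The first part of `β_i(x)`, for `i ≥ 2`. -/
noncomputable def betaCoeff1 (α : ℝ) (i : ℕ) (x : ℂ) : ℂ :=
  ((1 / ((α + 1) * ((i - 2)! : ℝ)) : ℝ) : ℂ) *
    ∑ j ∈ Finset.Icc 1 i,
      (((-1) ^ (i + j + 1) * Ring.choose (α + 2) (j - 1) * Ring.choose (α + 3) (i - j) *
        poch (α + 2) (i - j) : ℝ) : ℂ) * x ^ (j - 1)

/-- The second part of `β_i(x)`, for `i ≥ 2`. -/
noncomputable def betaCoeff2 (α : ℝ) (i : ℕ) (x : ℂ) : ℂ :=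
  ((2 * (α + 2) / ((α + 1) * ((i - 1)! : ℝ)) : ℝ) : ℂ) *
    ∑ j ∈ Finset.Icc 2 i,
      (((-1) ^ (i + j + 1) * Ring.choose (α + 1) (j - 2) * Ring.choose (α + 2) (i - j) *
        poch (α + 3) (i - j) : ℝ) : ℂ) * x ^ (j - 2)

/-- The third part of `β_i(x)`, for `i ≥ 2`. -/
noncomputable def betaCoeff3 (α : ℝ) (i : ℕ) (x : ℂ) : ℂ :=
  ((1 / ((α + 1) ^ 2 * (α + 2) * (α + 3) ^ 2 * ((i - 2)! : ℝ)) : ℝ) : ℂ) *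
    ∑ j ∈ Finset.Icc 0 i,
      (((-1) ^ (i + j + 1) * Ring.choose (α + 3) j * Ring.choose (α + 3) (i - j) *
        poch (α + 1) (i - j) *
        ((α + 1) * (α + 3) + (j : ℝ) * ((i : ℝ) - (j : ℝ))) : ℝ) : ℂ) * x ^ j

/-- The fourth part of `β_i(x)`, for `i ≥ 2`. -/
noncomputable def betaCoeff4 (α : ℝ) (i : ℕ) (x : ℂ) : ℂ :=
  ((((i : ℝ) - 2) / ((α + 1) ^ 2 * (α + 3) * (α + 4) ^ 2 * ((i - 2)! : ℝ)) : ℝ) : ℂ) *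
    ∑ j ∈ Finset.Icc 0 i,
      (((-1) ^ (i + j + 1) * Ring.choose (α + 4) j * Ring.choose (α + 4) (i - j) *
        poch (α + 1) (i - j) *
        ((α + 1) * (α + 4) + (j : ℝ) * ((i : ℝ) - (j : ℝ))) : ℝ) : ℂ) * x ^ j

/-- The polynomial `β_i(x)`, `i ≥ 1`: `β_1 = 0`, and for `i ≥ 2` it is the sum of the four parts.
The value at `i = 0` is a dummy that is never used. -/
noncomputable def betaCoeff (α : ℝ) (i : ℕ) (x : ℂ) : ℂ :=
  if i < 2 then 0
  else betaCoeff1 α i x + betaCoeff2 α i x + betaCoeff3 α i x + betaCoeff4 α i x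

end SobolevLaguerre

open Filter Topology

namespace SobolevLaguerre

/-! Up to constants, and a factor `x` for `aCoeff`, all the alternating sums are antidiagonal sums,
`n + k = i`, of one double series: `doubleTerm`, with general term (p)_n/n! · (a)_k (b)_k/k! · (K +
L n k)/Γ(n+k+a+b+1) · (-x)^n. The factorial in front of each sum is the reciprocal Gamma factor,
which depends only on `n + k`.

The double series converges absolutely (`exists_abs_doubleTerm_le`), so it may be summed over `k`
first. For weight 1 the inner sum is a Gauss sum with excess `n + 1` (`hasSum_gauss`); since `p = a
+ 1`, its value cancels (p)_n/n! and leaves a single hypergeometric series in `-x`. For weight `n k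
- a b` the inner sum telescopes (`hasSum_telescope`) to 0 unless `n = 0`, leaving a constant.

The reflection formula turns the Gamma constants into sin(πα)/π, and `hypergeometric_combination`
merges the contributions of the four parts of β. For α a nonnegative integer the sine vanishes and
only finitely many terms are nonzero. -/

theorem poch_zero {R : Type*} [CommRing R] (a : R) : poch a 0 = 1 := by
  simp [poch]

theorem poch_succ {R : Type*} [CommRing R] (a : R) (k : ℕ) :
    poch a (k + 1) = poch a k * (a + k) := by
  simp [poch, ascPochhammer_succ_eval]

theorem poch_eq_prod {R : Type*} [CommRing R] (a : R) (k : ℕ) :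
    poch a k = ∏ j ∈ Finset.range k, (a + j) := by
  induction k with
  | zero => simp [poch_zero]
  | succ k ih => rw [poch_succ, ih, Finset.prod_range_succ]

theorem poch_succ' {R : Type*} [CommRing R] (a : R) (k : ℕ) :
    poch a (k + 1) = a * poch (a + 1) k := by
  rw [poch_eq_prod, poch_eq_prod, Finset.prod_range_succ', mul_comm]
  simp only [Nat.cast_zero, add_zero]
  congr 1
  exact Finset.prod_congr rfl fun j _ => by push_cast; ring

theorem poch_one {R : Type*} [CommRing R] (k : ℕ) : poch (1 : R) k = (k ! : R) := by
  induction k with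
  | zero => simp [poch_zero]
  | succ k ih => rw [poch_succ, ih, Nat.factorial_succ]; push_cast; ring

theorem poch_pos {a : ℝ} (ha : 0 < a) (k : ℕ) : 0 < poch a k := by
  rw [poch_eq_prod]
  exact Finset.prod_pos fun j _ => by positivity

theorem ofReal_poch (a : ℝ) (k : ℕ) : ((poch a k : ℝ) : ℂ) = poch (a : ℂ) k := by
  simp [poch_eq_prod]

theorem poch_neg_natCast_eq_zero (m k : ℕ) (h : m < k) : poch (-(m : ℝ)) k = 0 := by
  rw [poch_eq_prod]
  exact Finset.prod_eq_zero (Finset.mem_range.2 h) (by simp)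

theorem ringChoose_eq_poch (a : ℝ) (k : ℕ) :
    Ring.choose a k = (-1) ^ k * (poch (-a) k / (k ! : ℝ)) := by
  simp only [Ring.choose_eq_smul, Polynomial.descPochhammer_smeval_eq_ascPochhammer,
    Polynomial.ascPochhammer_smeval_cast, Polynomial.ascPochhammer_smeval_eq_eval, poch,
    ascPochhammer_eval_neg_eq_descPochhammer, descPochhammer_eval_eq_ascPochhammer, smul_eq_mul]
  rw [mul_div_assoc, ← mul_assoc, ← mul_pow, neg_one_mul, neg_neg, one_pow, one_mul, div_eq_inv_mul]

theorem poch_mul_Gamma (a : ℝ) (ha : 0 < a) (k : ℕ) :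
    poch a k * Real.Gamma a = Real.Gamma (a + k) := by
  induction k with
  | zero => simp [poch_zero]
  | succ k ih =>
    rw [poch_succ, mul_right_comm, ih, Nat.cast_succ, ← add_assoc,
      Real.Gamma_add_one (by positivity), mul_comm]

/-- The recurrence for the reciprocal Gamma function, with no exceptional points. -/
theorem inv_Gamma_eq (s : ℝ) : (Real.Gamma s)⁻¹ = s * (Real.Gamma (s + 1))⁻¹ := by
  rcases eq_or_ne s 0 with rfl | h
  · simp [Real.Gamma_zero]
  · rw [Real.Gamma_add_one h, mul_inv, mul_inv_cancel_left₀ h]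

/-! ### Asymptotics of Pochhammer symbols and reciprocal Gamma values -/

theorem tendsto_natCast_div_add_one_rpow (r : ℝ) :
    Tendsto (fun N : ℕ => ((N : ℝ) / (N + 1)) ^ r) atTop (𝓝 1) := by
  have h := (tendsto_natCast_div_add_atTop (1 : ℝ)).rpow_const (p := r) (Or.inl one_ne_zero)
  simpa using h

/-- The asymptotics of the Pochhammer symbol. -/
theorem tendsto_poch_div (s : ℝ) :
    Tendsto (fun N : ℕ => poch s N / ((N ! : ℝ) * ((N : ℝ) + 1) ^ (s - 1))) atTop
      (𝓝 (Real.Gamma s)⁻¹) := by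
  by_cases hs : Real.Gamma s = 0
  -- At a pole `Real.Gamma` takes the value 0, so its inverse is the correct value 0 of 1/Γ; Euler's
  -- limit cannot be inverted there, but the symbol is eventually 0.
  · obtain ⟨m, rfl⟩ := (Real.Gamma_eq_zero_iff s).1 hs
    rw [hs, inv_zero]
    refine tendsto_const_nhds.congr' ?_
    filter_upwards [eventually_gt_atTop m] with N hN
    rw [poch_neg_natCast_eq_zero m N hN, zero_div]
  · have h1 := (Real.GammaSeq_tendsto_Gamma s).inv₀ hs
    have h2 : Tendsto (fun N : ℕ => (N : ℝ) / (N + s)) atTop (𝓝 1) :=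
      tendsto_natCast_div_add_atTop s
    have h3 := (h1.mul h2).mul (tendsto_natCast_div_add_one_rpow (s - 1))
    rw [mul_one, mul_one] at h3
    refine h3.congr' ?_
    filter_upwards [eventually_gt_atTop 0, tendsto_natCast_atTop_atTop.eventually_gt_atTop (-s)]
      with N hN hs'
    have hN' : (0 : ℝ) < N := by exact_mod_cast hN
    have hs'' : (N : ℝ) + s ≠ 0 := by linarith
    have h5 : (0 : ℝ) < (N : ℝ) ^ (s - 1) := by positivity
    have h6 : (0 : ℝ) < ((N : ℝ) + 1) ^ (s - 1) := by positivity
    -- Euler's product runs over `N + 1` factors; the extra factor `s + N` is what `h2` compensates.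
    rw [Real.GammaSeq, Finset.prod_range_succ, ← poch_eq_prod, Real.div_rpow hN'.le (by positivity),
      show (N : ℝ) ^ s = (N : ℝ) ^ (s - 1) * N by
        rw [← Real.rpow_add_one hN'.ne', sub_add_cancel]]
    have h7 : ((N ! : ℕ) : ℝ) ≠ 0 := by positivity
    field_simp
    ring

/-- The asymptotics of the reciprocal Gamma function along the integers. -/
theorem tendsto_inv_Gamma_mul (c : ℝ) :
    Tendsto (fun N : ℕ => (Real.Gamma (N + c))⁻¹ * ((N ! : ℝ) * ((N : ℝ) + 1) ^ (c - 1))) atTop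
      (𝓝 1) := by
  -- Descent to `c > 0`, where Γ(c) can be divided out; 1/Γ(N+c) = (N+c)/Γ(N+c+1) lowers `c` by one.
  obtain ⟨m, hm⟩ := exists_nat_gt (-c)
  induction m generalizing c with
  | zero =>
    have hc : 0 < c := by simpa using hm
    have hG := Real.Gamma_pos_of_pos hc
    have h := ((tendsto_poch_div c).mul_const (Real.Gamma c)).inv₀
      (by rw [inv_mul_cancel₀ hG.ne']; exact one_ne_zero)
    rw [inv_mul_cancel₀ hG.ne', inv_one] at h
    refine h.congr fun N => ?_
    rw [add_comm (N : ℝ) c, ← poch_mul_Gamma c hc]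
    have := poch_pos hc N
    field_simp
  | succ m ih =>
    have h := ih (c + 1) (by push_cast at hm; linarith)
    have h2 : Tendsto (fun N : ℕ => ((N : ℝ) + c) / (N + 1)) atTop (𝓝 1) := by
      have h3 := (tendsto_natCast_div_add_atTop (1 : ℝ)).add
        ((tendsto_one_div_add_atTop_nhds_zero_nat (𝕜 := ℝ)).const_mul c)
      rw [mul_zero, add_zero] at h3
      exact h3.congr fun N => by ring
    have h3 := h.mul h2
    rw [mul_one] at h3
    refine h3.congr fun N => ?_
    have hN : (0 : ℝ) < (N : ℝ) + 1 := by positivity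
    rw [inv_Gamma_eq (N + c), add_sub_cancel_right, Real.rpow_sub_one hN.ne', add_assoc]
    ring

theorem exists_abs_poch_le (s : ℝ) :
    ∃ C : ℝ, 0 ≤ C ∧ ∀ k : ℕ, |poch s k| ≤ C * ((k ! : ℝ) * ((k : ℝ) + 1) ^ (s - 1)) := by
  obtain ⟨C, hC⟩ := (Metric.isBounded_range_of_tendsto _ (tendsto_poch_div s)).exists_norm_le
  refine ⟨C, (norm_nonneg _).trans (hC _ ⟨0, rfl⟩), fun k => ?_⟩
  have h : (0 : ℝ) < (k ! : ℝ) * ((k : ℝ) + 1) ^ (s - 1) := by positivity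
  have := hC _ ⟨k, rfl⟩
  rwa [Real.norm_eq_abs, abs_div, abs_of_pos h, div_le_iff₀ h] at this

theorem exists_abs_inv_Gamma_le (c : ℝ) :
    ∃ C : ℝ, 0 ≤ C ∧
      ∀ k : ℕ, |(Real.Gamma (k + c))⁻¹| ≤ C * (((k : ℝ) + 1) ^ (1 - c) / (k ! : ℝ)) := by
  obtain ⟨C, hC⟩ := (Metric.isBounded_range_of_tendsto _ (tendsto_inv_Gamma_mul c)).exists_norm_le
  refine ⟨C, (norm_nonneg _).trans (hC _ ⟨0, rfl⟩), fun k => ?_⟩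
  have h : (0 : ℝ) < (k ! : ℝ) * ((k : ℝ) + 1) ^ (c - 1) := by positivity
  have := hC _ ⟨k, rfl⟩
  rw [Real.norm_eq_abs, abs_mul, abs_of_pos h, ← le_div_iff₀ h] at this
  refine this.trans_eq ?_
  rw [← neg_sub c 1, Real.rpow_neg (by positivity)]
  field_simp

/-! ### Telescoping and Gauss summation at argument one -/

/-- The telescoping identity behind the summation formulas at argument one. -/
theorem sum_range_telescope (a b c : ℝ) (N : ℕ) :
    ∑ k ∈ Finset.range N, poch a k * poch b k / (k ! : ℝ) * (Real.Gamma (c + 1 + k))⁻¹ *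
      ((c - a - b) * k - a * b) =
    -(N * (poch a N * poch b N / (N ! : ℝ)) * (Real.Gamma (c + N))⁻¹) := by
  induction N with
  | zero => simp
  | succ N ih =>
    rw [Finset.sum_range_succ, ih, inv_Gamma_eq (c + N), poch_succ, poch_succ, Nat.factorial_succ,
      show c + ((N + 1 : ℕ) : ℝ) = c + 1 + N by push_cast; ring,
      show c + (N : ℝ) + 1 = c + 1 + N by ring]
    have : (N ! : ℝ) ≠ 0 := by positivity
    push_cast
    field_simp
    ring

/-- The normalized size of the boundary term in the telescoping identity. -/
theorem tendsto_boundary (a b c : ℝ) :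
    Tendsto (fun N : ℕ => (poch a N * poch b N / (N ! : ℝ)) * (Real.Gamma (c + N))⁻¹ *
      ((N : ℝ) + 1) ^ (c + 1 - a - b)) atTop (𝓝 ((Real.Gamma a)⁻¹ * (Real.Gamma b)⁻¹)) := by
  have h := ((tendsto_poch_div a).mul (tendsto_poch_div b)).mul (tendsto_inv_Gamma_mul c)
  rw [mul_one] at h
  refine h.congr fun N => ?_
  have hN : (0 : ℝ) < (N : ℝ) + 1 := by positivity
  have h1 : (N ! : ℝ) ≠ 0 := by positivity
  rw [show c + 1 - a - b = (c - 1) - (a - 1) - (b - 1) by ring, Real.rpow_sub hN _ (b - 1),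
    Real.rpow_sub hN _ (a - 1), add_comm (N : ℝ) c]
  have h2 : (0 : ℝ) < ((N : ℝ) + 1) ^ (a - 1) := by positivity
  have h3 : (0 : ℝ) < ((N : ℝ) + 1) ^ (b - 1) := by positivity
  generalize ((N : ℝ) + 1) ^ (a - 1) = A at *
  generalize ((N : ℝ) + 1) ^ (b - 1) = B at *
  field_simp

theorem summable_succ_rpow {r : ℝ} (hr : r < -1) : Summable fun k : ℕ => ((k : ℝ) + 1) ^ r := by
  have h := (summable_nat_add_iff 1).2 (Real.summable_nat_rpow.2 hr)
  exact_mod_cast h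

/-- Convergence of the Gauss series at argument one. -/
theorem summable_gauss {a b c : ℝ} (h : a + b < c) :
    Summable fun k : ℕ => poch a k * poch b k / (k ! : ℝ) * (Real.Gamma (c + k))⁻¹ := by
  obtain ⟨C, hC⟩ := (Metric.isBounded_range_of_tendsto _ (tendsto_boundary a b c)).exists_norm_le
  refine Summable.of_norm_bounded
    ((summable_succ_rpow (r := -(c + 1 - a - b)) (by linarith)).mul_left C) fun k => ?_
  have h1 := hC _ ⟨k, rfl⟩
  have hk : (0 : ℝ) < ((k : ℝ) + 1) ^ (c + 1 - a - b) := by positivity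
  rw [norm_mul _ (_ ^ _), Real.norm_of_nonneg hk.le, ← le_div_iff₀ hk] at h1
  rwa [Real.rpow_neg (by positivity), ← div_eq_mul_inv]

/-- The partial sums are boundary terms of order N^(-(c-a-b)), so a nonzero limit can survive only
for `c = a + b`. Regularized by 1/Γ, the formula has no exceptional parameters. -/
theorem hasSum_telescope {a b c : ℝ} (h : a + b ≤ c) :
    HasSum (fun k : ℕ => poch a k * poch b k / (k ! : ℝ) * (Real.Gamma (c + 1 + k))⁻¹ *
        ((c - a - b) * k - a * b))
      (if c = a + b then -((Real.Gamma a)⁻¹ * (Real.Gamma b)⁻¹) else 0) := by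
  have hs : Summable fun k : ℕ => poch a k * poch b k / (k ! : ℝ) *
      (Real.Gamma (c + 1 + k))⁻¹ * ((c - a - b) * k - a * b) := by
    -- The summand is (c-a-b) times the Gauss term at `c` minus (c-a)(c-b) times the one at `c + 1`.
    -- For `c = a + b` the first coefficient is 0, so convergence at `c` is not needed.
    have h1 : Summable fun k : ℕ =>
        (c - a - b) * (poch a k * poch b k / (k ! : ℝ) * (Real.Gamma (c + k))⁻¹) := by
      rcases h.eq_or_lt with h | h
      · simp [← h]
      · exact (summable_gauss h).mul_left _
    have h2 := (summable_gauss (c := c + 1) (h.trans_lt (lt_add_one c))).mul_left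
      ((c - a) * (c - b))
    refine (h1.sub h2).congr fun k => ?_
    rw [inv_Gamma_eq (c + k), add_right_comm c]
    ring
  rw [hs.hasSum_iff_tendsto_nat]
  simp only [sum_range_telescope]
  have h1 : Tendsto (fun N : ℕ => (N : ℝ) / (N + 1)) atTop (𝓝 1) :=
    tendsto_natCast_div_add_atTop (1 : ℝ)
  have h2 : Tendsto (fun N : ℕ => ((N : ℝ) + 1) ^ (-(c - (a + b)))) atTop
      (𝓝 (if c = a + b then 1 else 0)) := by
    split_ifs with hc
    · simp [hc]
    · refine (tendsto_rpow_neg_atTop (sub_pos.2 (lt_of_le_of_ne h (Ne.symm hc)))).comp ?_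
      exact tendsto_atTop_add_const_right _ _ tendsto_natCast_atTop_atTop
  have h3 := (((tendsto_boundary a b c).mul h1).mul h2).neg
  have h4 : -((Real.Gamma a)⁻¹ * (Real.Gamma b)⁻¹ * 1 * (if c = a + b then 1 else 0)) =
      if c = a + b then -((Real.Gamma a)⁻¹ * (Real.Gamma b)⁻¹) else 0 := by
    split_ifs <;> simp
  rw [h4] at h3
  refine h3.congr fun N => ?_
  have hN : (0 : ℝ) < (N : ℝ) + 1 := by positivity
  have h5 : (0 : ℝ) < ((N : ℝ) + 1) ^ (c - (a + b)) := by positivity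
  rw [show c + 1 - a - b = c - (a + b) + 1 by ring, Real.rpow_neg hN.le,
    Real.rpow_add_one hN.ne']
  field_simp

/-- Gauss's summation formula in the case of positive integral excess. -/
theorem hasSum_gauss {a b : ℝ} (ha : a ≠ 0) (hb : 0 < b) (n : ℕ) :
    HasSum (fun k : ℕ => poch (a + 1) n *
        (poch a k * poch b k / (k ! : ℝ) * (Real.Gamma (a + b + 1 + n + k))⁻¹))
      ((n ! : ℝ) * ((Real.Gamma (a + 1))⁻¹ * (Real.Gamma (b + 1 + n))⁻¹)) := by
  induction n with
  | zero =>
    -- At `c = a + b` the telescoping weight is the constant `-a b`.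
    have h := (hasSum_telescope (le_refl (a + b))).mul_left (-(a * b)⁻¹)
    rw [if_pos rfl, inv_Gamma_eq a, inv_Gamma_eq b] at h
    convert! h using 1
    · ext k
      simp only [poch_zero, Nat.cast_zero, add_zero]
      rw [show a + b - a - b = 0 by ring]
      field_simp
      simp
      ring
    · simp only [Nat.factorial_zero, Nat.cast_zero, Nat.cast_one, add_zero]
      field_simp
  | succ n ih =>
    set c : ℝ := a + b + 1 + n with hc
    have hn : (0 : ℝ) < n + 1 := by positivity
    -- The vanishing telescoped sum relates the Gauss sums at `c` and `c + 1`. The factor `c - b = a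
    -- + 1 + n` is absorbed into `poch (a + 1) (n + 1)`; only `c - a = b + 1 + n > 0` is divided
    -- out.
    have h := (hasSum_telescope (a := a) (b := b) (c := c) (by linarith)).mul_left
      (poch (a + 1) n)
    rw [if_neg (by linarith)] at h
    have hb' : b + 1 + n ≠ 0 := by positivity
    convert! ((ih.mul_left (c - a - b)).sub h).mul_left (b + 1 + n)⁻¹ using 1
    · ext k
      rw [show a + b + 1 + ((n + 1 : ℕ) : ℝ) = c + 1 by rw [hc]; push_cast; ring, poch_succ,
        inv_Gamma_eq (c + k), add_right_comm c]
      field_simp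
      rw [hc]
      ring
    · rw [inv_Gamma_eq (b + 1 + n), Nat.factorial_succ, hc]
      push_cast
      field_simp
      ring_nf

/-! ### The double series and its absolute convergence -/

/-- The coefficients of the double series which underlie all the sums of this file. -/
noncomputable def doubleTerm (p a b K L : ℝ) (n k : ℕ) : ℝ :=
  poch p n / (n ! : ℝ) * (poch a k * poch b k / (k ! : ℝ)) *
    (Real.Gamma (((n + k : ℕ) : ℝ) + (a + b + 1)))⁻¹ * (K + L * (n * k))

theorem factorial_mul_factorial_le (n k : ℕ) : (k ! : ℝ) * (n ! : ℝ) ≤ ((n + k)! : ℝ) := by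
  exact_mod_cast Nat.le_of_dvd (Nat.factorial_pos _)
    ((mul_comm (k !) (n !)) ▸ Nat.factorial_mul_factorial_dvd_factorial_add n k)

/-- The weight `n k` must cost powers of `n` only, which 1/n! absorbs; the decay in `k` has no power
to spare. The factor `k` is hidden in `(k + 1)!`. -/
theorem mul_factorial_mul_factorial_le (n k : ℕ) :
    (n * k : ℝ) * ((k ! : ℝ) * (n ! : ℝ)) ≤ ((n : ℝ) + 1) ^ 2 * ((n + k)! : ℝ) := by
  cases n with
  | zero => simp
  | succ m =>
    have h := factorial_mul_factorial_le m (k + 1)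
    rw [← add_assoc, add_right_comm m k 1, Nat.factorial_succ k] at h
    rw [Nat.factorial_succ m]
    push_cast at h ⊢
    have h1 : (0 : ℝ) ≤ (k ! : ℝ) * (m ! : ℝ) := by positivity
    have h2 : (0 : ℝ) < ((m + 1 + k)! : ℝ) := by positivity
    have h3 : (0 : ℝ) ≤ m := by positivity
    calc ((m + 1 : ℝ) * k) * ((k ! : ℝ) * ((m + 1) * (m ! : ℝ)))
        = (m + 1) ^ 2 * (k * ((k ! : ℝ) * (m ! : ℝ))) := by ring
      _ ≤ (m + 1) ^ 2 * ((m + 1 + k)! : ℝ) := by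
          refine mul_le_mul_of_nonneg_left (le_trans ?_ h) (by positivity)
          nlinarith
      _ ≤ _ := by gcongr; linarith

theorem weight_mul_factorial_div_le (K L : ℝ) (n k : ℕ) :
    |K + L * (n * k)| * ((k ! : ℝ) / ((n + k)! : ℝ)) ≤
      (|K| + |L|) * (((n : ℝ) + 1) ^ 2 / (n ! : ℝ)) := by
  have hn : (0 : ℝ) < (n ! : ℝ) := by positivity
  have hnk : (0 : ℝ) < ((n + k)! : ℝ) := by positivity
  rw [mul_div_assoc', mul_div_assoc', div_le_div_iff₀ hnk hn]
  have h1 : |K + L * (n * k)| ≤ |K| + |L| * (n * k) := by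
    refine (abs_add_le _ _).trans_eq ?_
    rw [abs_mul L, abs_of_nonneg (by positivity : (0 : ℝ) ≤ n * k)]
  have h2 : (1 : ℝ) ≤ ((n : ℝ) + 1) ^ 2 := one_le_pow₀ (by linarith [Nat.cast_nonneg (α := ℝ) n])
  calc |K + L * (n * k)| * (k ! : ℝ) * (n ! : ℝ)
      ≤ (|K| + |L| * (n * k)) * (k ! : ℝ) * (n ! : ℝ) := by gcongr
    _ = |K| * (1 * ((k ! : ℝ) * (n ! : ℝ))) + |L| * ((n * k) * ((k ! : ℝ) * (n ! : ℝ))) := by ring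
    _ ≤ |K| * (((n : ℝ) + 1) ^ 2 * ((n + k)! : ℝ)) +
          |L| * (((n : ℝ) + 1) ^ 2 * ((n + k)! : ℝ)) := by
        have h3 := factorial_mul_factorial_le n k
        have h4 := mul_factorial_mul_factorial_le n k
        gcongr ?_ * ?_ + ?_ * ?_
        exact mul_le_mul h2 h3 (by positivity) (by positivity)
    _ = _ := by ring

theorem add_succ_rpow_le (r : ℝ) (n k : ℕ) :
    (((n + k : ℕ) : ℝ) + 1) ^ r ≤ ((n : ℝ) + 1) ^ |r| * ((k : ℝ) + 1) ^ r := by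
  have hn : (1 : ℝ) ≤ (n : ℝ) + 1 := by linarith [Nat.cast_nonneg (α := ℝ) n]
  have hk : (0 : ℝ) < (k : ℝ) + 1 := by positivity
  push_cast
  rcases le_total 0 r with hr | hr
  · rw [abs_of_nonneg hr, ← Real.mul_rpow (by positivity) hk.le]
    refine Real.rpow_le_rpow (by positivity) ?_ hr
    have : (0 : ℝ) ≤ n * k := by positivity
    linarith
  · calc ((n : ℝ) + k + 1) ^ r ≤ ((k : ℝ) + 1) ^ r :=
          Real.rpow_le_rpow_of_nonpos hk (by linarith) hr
      _ ≤ _ := le_mul_of_one_le_left (by positivity) (Real.one_le_rpow hn (abs_nonneg r))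

/-- The powers of `k + 1` from the two Pochhammer symbols and from 1/Γ add up to exactly -2,
whatever `a` and `b` are. -/
theorem exists_abs_doubleTerm_le (p a b K L : ℝ) :
    ∃ C : ℝ, ∃ s : ℝ, ∀ n k : ℕ, |doubleTerm p a b K L n k| ≤
      C * (((n : ℝ) + 1) ^ s / (n ! : ℝ)) * ((k : ℝ) + 1) ^ (-2 : ℝ) := by
  obtain ⟨A, hA, hA'⟩ := exists_abs_poch_le p
  obtain ⟨B, hB, hB'⟩ := exists_abs_poch_le a
  obtain ⟨C, hC, hC'⟩ := exists_abs_poch_le b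
  obtain ⟨D, hD, hD'⟩ := exists_abs_inv_Gamma_le (a + b + 1)
  refine ⟨A * B * C * D * (|K| + |L|), (p - 1) + |1 - (a + b + 1)| + 2, fun n k => ?_⟩
  have hn : (0 : ℝ) < (n : ℝ) + 1 := by positivity
  have hk : (0 : ℝ) < (k : ℝ) + 1 := by positivity
  have hn' : (0 : ℝ) < (n ! : ℝ) := by positivity
  have hk' : (0 : ℝ) < (k ! : ℝ) := by positivity
  have hnk' : (0 : ℝ) < ((n + k)! : ℝ) := by positivity
  set r := 1 - (a + b + 1) with hr
  have e1 : |doubleTerm p a b K L n k| = |poch p n| / (n ! : ℝ) *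
      (|poch a k| * |poch b k| / (k ! : ℝ)) *
      |(Real.Gamma (((n + k : ℕ) : ℝ) + (a + b + 1)))⁻¹| * |K + L * (n * k)| := by
    rw [doubleTerm, abs_mul, abs_mul, abs_mul, abs_div, abs_div, abs_mul, abs_of_pos hn',
      abs_of_pos hk']
  have e2 : ((k : ℝ) + 1) ^ (-2 : ℝ) =
      ((k : ℝ) + 1) ^ (a - 1) * ((k : ℝ) + 1) ^ (b - 1) * ((k : ℝ) + 1) ^ r := by
    rw [← Real.rpow_add hk, ← Real.rpow_add hk]
    congr 1
    rw [hr]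
    ring
  have e3 : ((n : ℝ) + 1) ^ ((p - 1) + |r| + 2) =
      ((n : ℝ) + 1) ^ (p - 1) * ((n : ℝ) + 1) ^ |r| * ((n : ℝ) + 1) ^ 2 := by
    rw [Real.rpow_add hn, Real.rpow_add hn, Real.rpow_two]
  rw [e1, e2, e3]
  calc _ ≤ (A * ((n ! : ℝ) * ((n : ℝ) + 1) ^ (p - 1))) / (n ! : ℝ) *
        ((B * ((k ! : ℝ) * ((k : ℝ) + 1) ^ (a - 1))) *
          (C * ((k ! : ℝ) * ((k : ℝ) + 1) ^ (b - 1))) / (k ! : ℝ)) *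
        (D * ((((n : ℝ) + 1) ^ |r| * ((k : ℝ) + 1) ^ r) / ((n + k)! : ℝ))) *
          |K + L * (n * k)| := by
        gcongr
        · exact hA' n
        · exact hB' k
        · exact hC' k
        · refine (hD' (n + k)).trans ?_
          gcongr
          exact add_succ_rpow_le r n k
    _ = A * B * C * D * ((n : ℝ) + 1) ^ (p - 1) * ((n : ℝ) + 1) ^ |r| *
        (((k : ℝ) + 1) ^ (a - 1) * ((k : ℝ) + 1) ^ (b - 1) * ((k : ℝ) + 1) ^ r) *
        (|K + L * (n * k)| * ((k ! : ℝ) / ((n + k)! : ℝ))) := by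
        field_simp
    _ ≤ A * B * C * D * ((n : ℝ) + 1) ^ (p - 1) * ((n : ℝ) + 1) ^ |r| *
        (((k : ℝ) + 1) ^ (a - 1) * ((k : ℝ) + 1) ^ (b - 1) * ((k : ℝ) + 1) ^ r) *
        ((|K| + |L|) * (((n : ℝ) + 1) ^ 2 / (n ! : ℝ))) :=
        mul_le_mul_of_nonneg_left (weight_mul_factorial_div_le K L n k) (by positivity)
    _ = _ := by ring

theorem summable_succ_rpow_mul_pow_div_factorial (s y : ℝ) (hy : 0 ≤ y) :
    Summable fun n : ℕ => ((n : ℝ) + 1) ^ s / (n ! : ℝ) * y ^ n := by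
  refine Summable.of_nonneg_of_le (fun n => by positivity) (fun n => ?_)
    (Real.summable_pow_div_factorial (Real.exp |s| * y))
  have h : ((n : ℝ) + 1) ^ s ≤ Real.exp |s| ^ n := by
    calc ((n : ℝ) + 1) ^ s ≤ ((n : ℝ) + 1) ^ |s| :=
          Real.rpow_le_rpow_of_exponent_le (by linarith [Nat.cast_nonneg (α := ℝ) n]) (le_abs_self s)
      _ ≤ Real.exp n ^ |s| :=
          Real.rpow_le_rpow (by positivity) (Real.add_one_le_exp _) (abs_nonneg s)
      _ = Real.exp |s| ^ n := by
          rw [← Real.exp_mul, ← Real.exp_nat_mul]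
  rw [mul_pow, div_mul_eq_mul_div]
  gcongr

theorem summable_norm_doubleTerm (p a b K L : ℝ) (y : ℂ) :
    Summable fun q : ℕ × ℕ => ‖(doubleTerm p a b K L q.1 q.2 : ℂ) * y ^ q.1‖ := by
  obtain ⟨C, s, h⟩ := exists_abs_doubleTerm_le p a b K L
  have h1 := (summable_succ_rpow_mul_pow_div_factorial s ‖y‖ (norm_nonneg y)).mul_left C
  have h2 := summable_succ_rpow (r := -2) (by norm_num)
  have h3 := summable_mul_of_summable_norm h1.norm h2.norm
  refine Summable.of_nonneg_of_le (fun q => norm_nonneg _) (fun q => ?_) h3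
  rw [norm_mul, norm_pow, Complex.norm_real, Real.norm_eq_abs]
  calc _ ≤ C * (((q.1 : ℝ) + 1) ^ s / (q.1 ! : ℝ)) * ((q.2 : ℝ) + 1) ^ (-2 : ℝ) * ‖y‖ ^ q.1 := by
        gcongr
        exact h q.1 q.2
    _ = _ := by ring

/-! ### Summation by diagonals and by rows -/

theorem summable_norm_sum_antidiagonal {f : ℕ × ℕ → ℂ} (hf : Summable fun q => ‖f q‖) :
    Summable fun i : ℕ => ‖∑ q ∈ Finset.HasAntidiagonal.antidiagonal i, f q‖ := by
  have h := (Finset.HasAntidiagonal.sigmaAntidiagonalEquivProd (A := ℕ)).summable_iff.2 hf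
  refine Summable.of_nonneg_of_le (fun i => norm_nonneg _) (fun i => norm_sum_le _ _) ?_
  refine h.sigma.congr fun i => ?_
  rw [tsum_fintype]
  exact Finset.sum_coe_sort (Finset.HasAntidiagonal.antidiagonal i) fun q => ‖f q‖

theorem hasSum_sum_antidiagonal {f : ℕ × ℕ → ℂ} (hf : Summable fun q => ‖f q‖) {g : ℕ → ℂ}
    (hg : ∀ n, HasSum (fun k => f (n, k)) (g n)) :
    HasSum (fun i : ℕ => ∑ q ∈ Finset.HasAntidiagonal.antidiagonal i, f q) (∑' n, g n) := by
  have h1 : Summable f := hf.of_norm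
  have h2 : HasSum f (∑' n, g n) := by
    have h3 := h1.hasSum.prod_fiberwise hg
    rw [h3.tsum_eq]
    exact h1.hasSum
  have h4 := (Finset.HasAntidiagonal.sigmaAntidiagonalEquivProd (A := ℕ)).hasSum_iff.2 h2
  refine h4.sigma fun i => ?_
  have h5 := hasSum_fintype fun q : Finset.HasAntidiagonal.antidiagonal i => f q
  rwa [Finset.sum_coe_sort (Finset.HasAntidiagonal.antidiagonal i) f] at h5

/-- The diagonal sums of the double series. -/
noncomputable def diagSum (p a b K L : ℝ) (y : ℂ) (i : ℕ) : ℂ :=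
  ∑ q ∈ Finset.HasAntidiagonal.antidiagonal i, (doubleTerm p a b K L q.1 q.2 : ℂ) * y ^ q.1

theorem summable_norm_diagSum (p a b K L : ℝ) (y : ℂ) :
    Summable fun i : ℕ => ‖diagSum p a b K L y i‖ :=
  summable_norm_sum_antidiagonal (summable_norm_doubleTerm p a b K L y)

/-- Row `n` is a Gauss sum; with `p = a + 1` its prefactor `poch p n` is the one in `hasSum_gauss`.
-/
theorem hasSum_diagSum_gauss {p a b : ℝ} (hp : p = a + 1) (ha : a ≠ 0) (hb : 0 < b) (y : ℂ) :
    HasSum (diagSum p a b 1 0 y)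
      (∑' n : ℕ, (((Real.Gamma p)⁻¹ * (Real.Gamma (b + 1 + n))⁻¹ : ℝ) : ℂ) * y ^ n) := by
  subst hp
  refine hasSum_sum_antidiagonal (summable_norm_doubleTerm (a + 1) a b 1 0 y) fun n => ?_
  suffices h : HasSum (fun k => doubleTerm (a + 1) a b 1 0 n k)
      ((Real.Gamma (a + 1))⁻¹ * (Real.Gamma (b + 1 + n))⁻¹) from
    (Complex.hasSum_ofReal.2 h).mul_right (y ^ n)
  have hn : (n ! : ℝ) ≠ 0 := by positivity
  convert! (hasSum_gauss ha hb n).mul_left (n ! : ℝ)⁻¹ using 1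
  · ext k
    rw [doubleTerm, show ((n + k : ℕ) : ℝ) + (a + b + 1) = a + b + 1 + n + k by push_cast; ring]
    ring
  · rw [inv_mul_cancel_left₀ hn]

/-- Row `n` is `hasSum_telescope` at `c = n + a + b`, where the weight is `n k - a b`; only row 0
contributes, hence no dependence on `p` or `y`. -/
theorem hasSum_diagSum_telescope (p a b : ℝ) (y : ℂ) :
    HasSum (diagSum p a b (-(a * b)) 1 y)
      ((-((Real.Gamma a)⁻¹ * (Real.Gamma b)⁻¹) : ℝ) : ℂ) := by
  have h1 : ∀ n : ℕ, HasSum (fun k => doubleTerm p a b (-(a * b)) 1 n k)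
      (poch p n / (n ! : ℝ) *
        (if (n : ℝ) + (a + b) = a + b then -((Real.Gamma a)⁻¹ * (Real.Gamma b)⁻¹) else 0)) := by
    intro n
    convert! (hasSum_telescope (a := a) (b := b) (c := n + (a + b))
      (by linarith [Nat.cast_nonneg (α := ℝ) n])).mul_left (poch p n / (n ! : ℝ)) using 1
    ext k
    rw [doubleTerm,
      show ((n + k : ℕ) : ℝ) + (a + b + 1) = n + (a + b) + 1 + k by push_cast; ring]
    ring
  have h := hasSum_sum_antidiagonal (summable_norm_doubleTerm p a b (-(a * b)) 1 y)
    fun n => (Complex.hasSum_ofReal.2 (h1 n)).mul_right (y ^ n)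
  rw [tsum_eq_single 0 fun n hn => by simp [hn]] at h
  simp only [poch_zero, Nat.factorial_zero, Nat.cast_zero, Nat.cast_one, zero_add, if_true,
    div_one, one_mul, pow_zero, mul_one] at h
  exact h

/-! ### The polynomials as diagonal sums -/

theorem sum_Icc_eq_sum_antidiagonal (m i : ℕ) (F : ℕ → ℂ) :
    ∑ j ∈ Finset.Icc m (i + m), F j =
      ∑ q ∈ Finset.HasAntidiagonal.antidiagonal i, F (q.1 + m) := by
  rw [Finset.Nat.sum_antidiagonal_eq_sum_range_succ fun n _ => F (n + m), Finset.range_eq_Ico,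
    Finset.sum_Ico_add' F 0 (i + 1) m, zero_add, add_right_comm]
  rfl

theorem binomial_term_eq (A B b W : ℝ) (x : ℂ) (n k m : ℕ) :
    (((-1) ^ (n + k + m + (n + m) + 1) * Ring.choose A n * Ring.choose B k * poch b k * W : ℝ) : ℂ)
      * x ^ n =
    -(((poch (-A) n / (n ! : ℝ) * (poch (-B) k * poch b k / (k ! : ℝ)) * W : ℝ) : ℂ) *
      (-x) ^ n) := by
  have h : ((-1 : ℝ)) ^ (n + k + m + (n + m) + 1) * Ring.choose A n * Ring.choose B k *
      poch b k * W = -((-1) ^ n * (poch (-A) n / (n ! : ℝ) *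
        (poch (-B) k * poch b k / (k ! : ℝ)) * W)) := by
    have h1 : ((-1 : ℝ)) ^ (n + k + m + (n + m) + 1) * (-1) ^ k = -1 := by
      rw [← pow_add, show n + k + m + (n + m) + 1 + k = 2 * (n + m + k) + 1 by ring, pow_succ,
        pow_mul]
      simp
    rw [ringChoose_eq_poch, ringChoose_eq_poch]
    linear_combination ((-1) ^ n * (poch (-A) n / (n ! : ℝ) *
        (poch (-B) k * poch b k / (k ! : ℝ)) * W)) * h1
  rw [h, neg_pow x]
  push_cast
  ring

/-- Alternating binomial sums are diagonal sums of the double series. -/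
theorem mul_sum_Icc_eq_diagSum (m i : ℕ) (A B b K L G : ℝ) (x : ℂ)
    (hG : G = (Real.Gamma ((i : ℝ) + (-B + b + 1)))⁻¹) :
    (G : ℂ) * ∑ j ∈ Finset.Icc m (i + m),
      (((-1) ^ (i + m + j + 1) * Ring.choose A (j - m) * Ring.choose B (i + m - j) *
        poch b (i + m - j) * (K + L * (((j - m : ℕ) : ℝ) * ((i + m - j : ℕ) : ℝ))) : ℝ) : ℂ) *
          x ^ (j - m) = -diagSum (-A) (-B) b K L (-x) i := by
  rw [sum_Icc_eq_sum_antidiagonal, diagSum, ← Finset.sum_neg_distrib, Finset.mul_sum]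
  refine Finset.sum_congr rfl fun q hq => ?_
  obtain ⟨n, k⟩ := q
  obtain rfl : n + k = i := Finset.HasAntidiagonal.mem_antidiagonal.1 hq
  simp only
  rw [Nat.add_sub_cancel, show n + k + m - (n + m) = k by omega, binomial_term_eq, doubleTerm, hG]
  push_cast
  ring

theorem aCoeff_eq_diagSum (α : ℝ) (i : ℕ) (x : ℂ) :
    aCoeff α (i + 1) x = -x * diagSum (-(α + 1)) (-(α + 2)) (α + 3) 1 0 (-x) i := by
  have h := mul_sum_Icc_eq_diagSum 1 i (α + 1) (α + 2) (α + 3) 1 0 (1 / ((i + 1)! : ℝ)) x (by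
    rw [show (i : ℝ) + (-(α + 2) + (α + 3) + 1) = ((i + 1 : ℕ) : ℝ) + 1 by push_cast; ring,
      Real.Gamma_nat_eq_factorial, one_div])
  rw [neg_mul, ← mul_neg, ← h, aCoeff, mul_left_comm, Finset.mul_sum _ _ x]
  congr 1
  refine Finset.sum_congr rfl fun j hj => ?_
  obtain ⟨j, rfl⟩ := Nat.exists_eq_add_of_le' (Finset.mem_Icc.1 hj).1
  simp only [Nat.add_sub_cancel, pow_succ]
  push_cast
  ring

theorem betaCoeff1_eq_diagSum (α : ℝ) (i : ℕ) (x : ℂ) :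
    betaCoeff1 α (i + 2) x =
      -((1 / (α + 1) : ℝ) : ℂ) * diagSum (-(α + 2)) (-(α + 3)) (α + 2) 1 0 (-x) (i + 1) := by
  have h := mul_sum_Icc_eq_diagSum 1 (i + 1) (α + 2) (α + 3) (α + 2) 1 0 (1 / (i ! : ℝ)) x (by
    rw [show ((i + 1 : ℕ) : ℝ) + (-(α + 3) + (α + 2) + 1) = (i : ℝ) + 1 by push_cast; ring,
      Real.Gamma_nat_eq_factorial, one_div])
  rw [neg_mul, ← mul_neg, ← h, betaCoeff1, ← mul_assoc]
  congr 1
  · rw [← Complex.ofReal_mul, one_div_mul_one_div, Nat.add_sub_cancel]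
  · refine Finset.sum_congr rfl fun j hj => ?_
    simp only [zero_mul, add_zero, mul_one]

theorem betaCoeff2_eq_diagSum (α : ℝ) (i : ℕ) (x : ℂ) :
    betaCoeff2 α (i + 2) x =
      -((2 * (α + 2) / (α + 1) : ℝ) : ℂ) *
        diagSum (-(α + 1)) (-(α + 2)) (α + 3) 1 0 (-x) i := by
  have h := mul_sum_Icc_eq_diagSum 2 i (α + 1) (α + 2) (α + 3) 1 0 (1 / ((i + 1)! : ℝ)) x (by
    rw [show (i : ℝ) + (-(α + 2) + (α + 3) + 1) = ((i + 1 : ℕ) : ℝ) + 1 by push_cast; ring,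
      Real.Gamma_nat_eq_factorial, one_div])
  rw [neg_mul, ← mul_neg, ← h, betaCoeff2, ← mul_assoc]
  congr 1
  · rw [← Complex.ofReal_mul, div_mul_div_comm, mul_one, show i + 2 - 1 = i + 1 by omega]
  · refine Finset.sum_congr rfl fun j hj => ?_
    simp only [zero_mul, add_zero, mul_one]

theorem betaCoeff3_eq_diagSum (α : ℝ) (i : ℕ) (x : ℂ) :
    betaCoeff3 α (i + 2) x =
      -((1 / ((α + 1) ^ 2 * (α + 2) * (α + 3) ^ 2) : ℝ) : ℂ) *
        diagSum (-(α + 3)) (-(α + 3)) (α + 1) (-(-(α + 3) * (α + 1))) 1 (-x) (i + 2) := by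
  have h := mul_sum_Icc_eq_diagSum 0 (i + 2) (α + 3) (α + 3) (α + 1) (-(-(α + 3) * (α + 1))) 1
    (1 / (i ! : ℝ)) x (by
      rw [show ((i + 2 : ℕ) : ℝ) + (-(α + 3) + (α + 1) + 1) = (i : ℝ) + 1 by push_cast; ring,
        Real.Gamma_nat_eq_factorial, one_div])
  rw [neg_mul, ← mul_neg, ← h, betaCoeff3, ← mul_assoc]
  congr 1
  · rw [← Complex.ofReal_mul, one_div_mul_one_div, Nat.add_sub_cancel]
  · refine Finset.sum_congr rfl fun j hj => ?_
    have hj' := (Finset.mem_Icc.1 hj).2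
    simp only [add_zero, Nat.sub_zero]
    rw [Nat.cast_sub hj', neg_mul, neg_neg, one_mul, mul_comm (α + 3)]

theorem betaCoeff4_eq_diagSum (α : ℝ) (i : ℕ) (x : ℂ) :
    betaCoeff4 α (i + 2) x =
      -((1 / ((α + 1) ^ 2 * (α + 3) * (α + 4) ^ 2) : ℝ) : ℂ) *
        diagSum (-(α + 4)) (-(α + 4)) (α + 1) (-(-(α + 4) * (α + 1))) 1 (-x) (i + 2) := by
  have h := mul_sum_Icc_eq_diagSum 0 (i + 2) (α + 4) (α + 4) (α + 1) (-(-(α + 4) * (α + 1))) 1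
    (i / (i ! : ℝ)) x (by
      -- Here 1/Γ(i) = i/i!, also at `i = 0`; this accounts for the numerator of the prefactor.
      rw [show ((i + 2 : ℕ) : ℝ) + (-(α + 4) + (α + 1) + 1) = (i : ℝ) by push_cast; ring,
        inv_Gamma_eq, Real.Gamma_nat_eq_factorial, div_eq_mul_inv])
  rw [neg_mul, ← mul_neg, ← h, betaCoeff4, ← mul_assoc]
  congr 1
  · rw [← Complex.ofReal_mul, div_mul_div_comm, one_mul, Nat.add_sub_cancel, Nat.cast_add,
      Nat.cast_two, add_sub_cancel_right]
  · refine Finset.sum_congr rfl fun j hj => ?_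
    have hj' := (Finset.mem_Icc.1 hj).2
    simp only [add_zero, Nat.sub_zero]
    rw [Nat.cast_sub hj', neg_mul, neg_neg, one_mul, mul_comm (α + 4)]

/-! ### Vanishing diagonals and the Gamma constants -/

/-- A pole of Γ kills the whole diagonal. This supplies the initial diagonals absent from the parts
of β, which start at `i = 2`. -/
theorem diagSum_eq_zero {a b : ℝ} (p K L : ℝ) (y : ℂ) (i m : ℕ)
    (h : (i : ℝ) + (a + b + 1) = -m) : diagSum p a b K L y i = 0 := by
  refine Finset.sum_eq_zero fun q hq => ?_
  rw [doubleTerm, Finset.HasAntidiagonal.mem_antidiagonal.1 hq, h,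
    (Real.Gamma_eq_zero_iff _).2 ⟨m, rfl⟩]
  simp

theorem inv_Gamma_reflection (α : ℝ) :
    (Real.Gamma (-(α + 1)))⁻¹ * (Real.Gamma (α + 2))⁻¹ = Real.sin (Real.pi * α) / Real.pi := by
  have h := Real.Gamma_mul_Gamma_one_sub (α + 2)
  rw [show 1 - (α + 2) = -(α + 1) by ring,
    show Real.pi * (α + 2) = Real.pi * α + 2 * Real.pi by ring, Real.sin_add_two_pi] at h
  rw [← mul_inv, mul_comm, h, inv_div]

theorem inv_Gamma_mul_gauss_a {α : ℝ} (hα : -1 < α) (n : ℕ) :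
    (Real.Gamma (-(α + 1)))⁻¹ * (Real.Gamma (α + 3 + 1 + n))⁻¹ =
      Real.sin (Real.pi * α) / Real.pi / ((α + 2) * (α + 3)) * (poch (α + 4) n)⁻¹ := by
  have h1 : α + 2 ≠ 0 := by linarith
  have h2 : α + 3 ≠ 0 := by linarith
  rw [← inv_Gamma_reflection, inv_Gamma_eq (α + 2), show α + 2 + 1 = α + 3 by ring,
    inv_Gamma_eq (α + 3), show α + 3 + 1 = α + 4 by ring,
    ← poch_mul_Gamma (α + 4) (by linarith)]
  field_simp

theorem inv_Gamma_mul_gauss_beta {α : ℝ} (hα : -1 < α) (n : ℕ) :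
    (Real.Gamma (-(α + 2)))⁻¹ * (Real.Gamma (α + 2 + 1 + n))⁻¹ =
      -(Real.sin (Real.pi * α) / Real.pi) * (poch (α + 3) n)⁻¹ := by
  rw [← inv_Gamma_reflection, inv_Gamma_eq (-(α + 2)), inv_Gamma_eq (α + 2),
    show -(α + 2) + 1 = -(α + 1) by ring, show α + 2 + 1 = α + 3 by ring,
    ← poch_mul_Gamma (α + 3) (by linarith)]
  field_simp

theorem inv_Gamma_mul_telescope3 (α : ℝ) :
    -((Real.Gamma (-(α + 3)))⁻¹ * (Real.Gamma (α + 1))⁻¹) =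
      -((α + 1) * (α + 2) * (α + 3)) * (Real.sin (Real.pi * α) / Real.pi) := by
  rw [← inv_Gamma_reflection, inv_Gamma_eq (-(α + 3)), show -(α + 3) + 1 = -(α + 2) by ring,
    inv_Gamma_eq (-(α + 2)), show -(α + 2) + 1 = -(α + 1) by ring, inv_Gamma_eq (α + 1),
    show α + 1 + 1 = α + 2 by ring]
  ring

theorem inv_Gamma_mul_telescope4 (α : ℝ) :
    -((Real.Gamma (-(α + 4)))⁻¹ * (Real.Gamma (α + 1))⁻¹) =
      (α + 1) * (α + 2) * (α + 3) * (α + 4) * (Real.sin (Real.pi * α) / Real.pi) := by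
  have h := inv_Gamma_mul_telescope3 α
  rw [inv_Gamma_eq (-(α + 4)), show -(α + 4) + 1 = -(α + 3) by ring]
  linear_combination -(α + 4) * h

/-! ### Hypergeometric series -/

theorem factorial_le_poch {a : ℝ} (ha : 1 ≤ a) (n : ℕ) : (n ! : ℝ) ≤ poch a n := by
  rw [← poch_one, poch_eq_prod, poch_eq_prod]
  exact Finset.prod_le_prod (fun j _ => by positivity) fun j _ => by linarith

theorem summable_inv_poch_mul_pow {a : ℝ} (ha : 1 ≤ a) (y : ℂ) :
    Summable fun n : ℕ => (poch (a : ℂ) n)⁻¹ * y ^ n := by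
  refine Summable.of_norm_bounded (Real.summable_pow_div_factorial ‖y‖) fun n => ?_
  have h : (0 : ℝ) < (n ! : ℝ) := by positivity
  have h1 := factorial_le_poch ha n
  rw [norm_mul, norm_inv, norm_pow, ← ofReal_poch, Complex.norm_real,
    Real.norm_of_nonneg (h.le.trans h1), div_eq_inv_mul]
  gcongr

theorem pFq_one_singleton (b z : ℂ) :
    pFq {1} {b} z = ∑' n : ℕ, (poch b n)⁻¹ * z ^ n := by
  refine tsum_congr fun n => ?_
  have h : (n ! : ℂ) ≠ 0 := by exact_mod_cast (Nat.factorial_pos n).ne'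
  simp only [Multiset.map_singleton, Multiset.prod_singleton, poch_one]
  field_simp

theorem pFq_one_pair (a b c z : ℂ) :
    pFq {1, a} {b, c} z = ∑' n : ℕ, poch a n / (poch b n * poch c n) * z ^ n := by
  refine tsum_congr fun n => ?_
  have h : (n ! : ℂ) ≠ 0 := by exact_mod_cast (Nat.factorial_pos n).ne'
  simp only [Multiset.insert_eq_cons, Multiset.map_cons, Multiset.prod_cons,
    Multiset.map_singleton, Multiset.prod_singleton, poch_one]
  rw [mul_comm (n ! : ℂ), mul_div_mul_right _ _ h]

theorem ofReal_add_natCast_ne_zero {α : ℝ} (hα : -1 < α) (n : ℕ) : (α : ℂ) + 1 + n ≠ 0 := by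
  have h : α + 1 + n ≠ 0 := by
    have : (0 : ℝ) ≤ n := by positivity
    linarith
  exact_mod_cast h

/-- The four terms on the left come from the four parts of β, in order, after removing
sin(πα)/(π(α+1)). The identity holds coefficientwise in `y`, the two constants entering at order 0.
-/
theorem hypergeometric_combination {α : ℝ} (hα : -1 < α) (y : ℂ) :
    (∑' n : ℕ, (poch ((α : ℂ) + 3) n)⁻¹ * y ^ n) -
        2 / ((α : ℂ) + 3) * (∑' n : ℕ, (poch ((α : ℂ) + 4) n)⁻¹ * y ^ n) +
        1 / ((α : ℂ) + 3) - ((α : ℂ) + 2) / ((α : ℂ) + 4) =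
      ((α : ℂ) + 2) / (((α : ℂ) + 3) * ((α : ℂ) + 4)) *
        (1 + y * pFq {1, (α : ℂ) + 3} {(α : ℂ) + 2, (α : ℂ) + 5} y) := by
  have s1 : Summable fun n : ℕ => (poch ((α : ℂ) + 3) n)⁻¹ * y ^ n := by
    have := summable_inv_poch_mul_pow (a := α + 3) (by linarith) y
    push_cast at this
    exact this
  have s2 : Summable fun n : ℕ => (poch ((α : ℂ) + 4) n)⁻¹ * y ^ n := by
    have := summable_inv_poch_mul_pow (a := α + 4) (by linarith) y
    push_cast at this
    exact this
  have hne := ofReal_add_natCast_ne_zero hα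
  have h2 : (α : ℂ) + 2 ≠ 0 := by have := hne 1; norm_num [add_assoc] at this; exact this
  have h3 : (α : ℂ) + 3 ≠ 0 := by have := hne 2; norm_num [add_assoc] at this; exact this
  have h4 : (α : ℂ) + 4 ≠ 0 := by have := hne 3; norm_num [add_assoc] at this; exact this
  have key : (∑' n : ℕ, (poch ((α : ℂ) + 3) (n + 1))⁻¹ * y ^ (n + 1)) -
      2 / ((α : ℂ) + 3) * (∑' n : ℕ, (poch ((α : ℂ) + 4) (n + 1))⁻¹ * y ^ (n + 1)) =
      ((α : ℂ) + 2) / (((α : ℂ) + 3) * ((α : ℂ) + 4)) *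
        (y * pFq {1, (α : ℂ) + 3} {(α : ℂ) + 2, (α : ℂ) + 5} y) := by
    rw [pFq_one_pair, ← tsum_mul_left, ← tsum_mul_left, ← tsum_mul_left,
      ← ((summable_nat_add_iff 1).2 s1).tsum_sub (((summable_nat_add_iff 1).2 s2).mul_left _)]
    refine tsum_congr fun n => ?_
    have e1 : poch ((α : ℂ) + 3) n * ((α : ℂ) + 2) = poch ((α : ℂ) + 2) n * ((α : ℂ) + 2 + n) := by
      rw [← poch_succ, poch_succ']
      ring_nf
    have e2 : poch ((α : ℂ) + 4) (n + 1) = ((α : ℂ) + 4) * poch ((α : ℂ) + 5) n := by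
      rw [poch_succ', show (α : ℂ) + 4 + 1 = α + 5 by ring]
    have e3 : poch ((α : ℂ) + 3) (n + 1) * ((α : ℂ) + 3 + n + 1) =
        ((α : ℂ) + 3) * (((α : ℂ) + 4) * poch ((α : ℂ) + 5) n) := by
      rw [← e2, show (α : ℂ) + 4 = α + 3 + 1 by ring, ← poch_succ', poch_succ _ (n + 1)]
      push_cast
      ring
    have h5 : poch ((α : ℂ) + 5) n ≠ 0 := by
      have := (poch_pos (a := α + 5) (by linarith) n).ne'
      rw [← Complex.ofReal_ne_zero, ofReal_poch] at this
      push_cast at this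
      exact this
    have h6 : poch ((α : ℂ) + 2) n ≠ 0 := by
      have := (poch_pos (a := α + 2) (by linarith) n).ne'
      rw [← Complex.ofReal_ne_zero, ofReal_poch] at this
      push_cast at this
      exact this
    have h7 : (α : ℂ) + 3 + n + 1 ≠ 0 := by
      have := hne (n + 3)
      push_cast at this
      convert! this using 1
      ring
    have e4 := eq_div_of_mul_eq h7 e3
    have e5 := eq_div_of_mul_eq h2 e1
    rw [e2, e4, e5]
    field_simp
    ring
  rw [s1.tsum_eq_zero_add, s2.tsum_eq_zero_add, mul_add]
  simp only [poch_zero, pow_zero, inv_one, mul_one]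
  rw [mul_add, ← key]
  field_simp
  ring

/-! ### The two infinite sums -/

theorem summable_norm_aCoeff (α : ℝ) (x : ℂ) :
    Summable fun i : ℕ => ‖aCoeff α (i + 1) x‖ := by
  simp only [aCoeff_eq_diagSum, norm_mul]
  exact (summable_norm_diagSum (-(α + 1)) (-(α + 2)) (α + 3) 1 0 (-x)).mul_left ‖-x‖

theorem hasSum_aCoeff {α : ℝ} (hα : -1 < α) (x : ℂ) :
    HasSum (fun i : ℕ => aCoeff α (i + 1) x)
      (-((Real.sin (Real.pi * α) / Real.pi : ℝ) : ℂ) *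
        (x / (((α : ℂ) + 2) * ((α : ℂ) + 3))) * pFq {1} {(α : ℂ) + 4} (-x)) := by
  simp only [aCoeff_eq_diagSum]
  have h := (hasSum_diagSum_gauss (p := -(α + 1)) (a := -(α + 2)) (b := α + 3) (by ring)
    (by linarith) (by linarith) (-x)).mul_left (-x)
  simp only [inv_Gamma_mul_gauss_a hα] at h
  convert! h using 1
  rw [pFq_one_singleton, ← tsum_mul_left, ← tsum_mul_left]
  refine tsum_congr fun n => ?_
  rw [Complex.ofReal_mul, Complex.ofReal_inv, ofReal_poch]
  push_cast
  ring

theorem betaCoeff_add_two (α : ℝ) (i : ℕ) (x : ℂ) :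
    betaCoeff α (i + 2) x =
      betaCoeff1 α (i + 2) x + betaCoeff2 α (i + 2) x + betaCoeff3 α (i + 2) x +
        betaCoeff4 α (i + 2) x := by
  rw [betaCoeff, if_neg (by omega)]

theorem betaCoeff_one (α : ℝ) (x : ℂ) : betaCoeff α 1 x = 0 := by
  rw [betaCoeff, if_pos (by omega)]

theorem summable_norm_betaCoeff (α : ℝ) (x : ℂ) :
    Summable fun i : ℕ => ‖betaCoeff α (i + 1) x‖ := by
  rw [← summable_nat_add_iff 1]
  change Summable fun i : ℕ => ‖betaCoeff α (i + 2) x‖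
  simp only [betaCoeff_add_two, betaCoeff1_eq_diagSum,
    betaCoeff2_eq_diagSum, betaCoeff3_eq_diagSum, betaCoeff4_eq_diagSum]
  have key : ∀ (c : ℂ) (p a b K L : ℝ) (m : ℕ),
      Summable fun i : ℕ => ‖c * diagSum p a b K L (-x) (i + m)‖ := fun c p a b K L m => by
    simp only [norm_mul]
    exact ((summable_nat_add_iff m).2 (summable_norm_diagSum p a b K L (-x))).mul_left _
  refine Summable.of_nonneg_of_le (fun i => norm_nonneg _) (fun i => norm_add₄_le)
    (((Summable.add (key _ _ _ _ _ _ 1) (key _ _ _ _ _ _ 0)).add (key _ _ _ _ _ _ 2)).add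
      (key _ _ _ _ _ _ 2))

theorem hasSum_nat_add_of_eq_zero {f : ℕ → ℂ} {S : ℂ} (hf : HasSum f S) (m : ℕ)
    (h : ∀ i < m, f i = 0) : HasSum (fun i => f (i + m)) S := by
  have h1 := (hasSum_nat_add_iff' m).2 hf
  rwa [Finset.sum_eq_zero fun i hi => h i (Finset.mem_range.1 hi), sub_zero] at h1

theorem hasSum_betaCoeff {α : ℝ} (hα : -1 < α) (x : ℂ) :
    HasSum (fun i : ℕ => betaCoeff α (i + 1) x)
      (((Real.sin (Real.pi * α) / Real.pi : ℝ) : ℂ) *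
        (((α : ℂ) + 2) / (((α : ℂ) + 1) * ((α : ℂ) + 3) * ((α : ℂ) + 4))) *
        (1 - x * pFq {1, (α : ℂ) + 3} {(α : ℂ) + 2, (α : ℂ) + 5} (-x))) := by
  rw [← hasSum_nat_add_iff' 1]
  simp only [Finset.range_one, Finset.sum_singleton, zero_add, betaCoeff_one, sub_zero]
  change HasSum (fun i : ℕ => betaCoeff α (i + 2) x) _
  simp only [betaCoeff_add_two, betaCoeff1_eq_diagSum,
    betaCoeff2_eq_diagSum, betaCoeff3_eq_diagSum, betaCoeff4_eq_diagSum]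
  -- Parts 1, 3, 4 have `a + b + 1` equal to 0, -1, -2, so the diagonals skipped (one, two, two) sit
  -- at poles of Γ. Part 2 skips none.
  have h1 := (hasSum_nat_add_of_eq_zero (hasSum_diagSum_gauss (p := -(α + 2)) (a := -(α + 3))
    (b := α + 2) (by ring) (by linarith) (by linarith) (-x)) 1 (fun i hi => by
      refine diagSum_eq_zero _ _ _ _ i 0 ?_
      obtain rfl : i = 0 := by omega
      push_cast
      ring)).mul_left (-((1 / (α + 1) : ℝ) : ℂ))
  have h2 := (hasSum_diagSum_gauss (p := -(α + 1)) (a := -(α + 2)) (b := α + 3) (by ring)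
    (by linarith) (by linarith) (-x)).mul_left (-((2 * (α + 2) / (α + 1) : ℝ) : ℂ))
  have h3 := (hasSum_nat_add_of_eq_zero
    (hasSum_diagSum_telescope (-(α + 3)) (-(α + 3)) (α + 1) (-x)) 2
    (fun i hi => by
      refine diagSum_eq_zero _ _ _ _ i (1 - i) ?_
      rw [Nat.cast_sub (by omega)]
      push_cast
      ring)).mul_left (-((1 / ((α + 1) ^ 2 * (α + 2) * (α + 3) ^ 2) : ℝ) : ℂ))
  have h4 := (hasSum_nat_add_of_eq_zero
    (hasSum_diagSum_telescope (-(α + 4)) (-(α + 4)) (α + 1) (-x)) 2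
    (fun i hi => by
      refine diagSum_eq_zero _ _ _ _ i (2 - i) ?_
      rw [Nat.cast_sub (by omega)]
      push_cast
      ring)).mul_left (-((1 / ((α + 1) ^ 2 * (α + 3) * (α + 4) ^ 2) : ℝ) : ℂ))
  simp only [inv_Gamma_mul_gauss_a hα, inv_Gamma_mul_gauss_beta hα, inv_Gamma_mul_telescope3,
    inv_Gamma_mul_telescope4] at h1 h2 h3 h4
  convert! ((h1.add h2).add h3).add h4 using 1
  have hc := hypergeometric_combination hα (-x)
  have e1 : ∀ (c a : ℝ), (∑' n : ℕ, ((c * (poch a n)⁻¹ : ℝ) : ℂ) * (-x) ^ n) =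
      c * ∑' n : ℕ, (poch (a : ℂ) n)⁻¹ * (-x) ^ n := fun c a => by
    rw [← tsum_mul_left]
    refine tsum_congr fun n => ?_
    rw [Complex.ofReal_mul, Complex.ofReal_inv, ofReal_poch, mul_assoc]
  rw [e1, e1]
  have hne := ofReal_add_natCast_ne_zero hα
  have n1 : (α : ℂ) + 1 ≠ 0 := by simpa using hne 0
  have n2 : (α : ℂ) + 2 ≠ 0 := by have := hne 1; norm_num [add_assoc] at this; exact this
  have n3 : (α : ℂ) + 3 ≠ 0 := by have := hne 2; norm_num [add_assoc] at this; exact this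
  have n4 : (α : ℂ) + 4 ≠ 0 := by have := hne 3; norm_num [add_assoc] at this; exact this
  generalize Real.sin (Real.pi * α) / Real.pi = s
  rw [sub_eq_add_neg (1 : ℂ), ← neg_mul,
    show (s : ℂ) * (((α : ℂ) + 2) / (((α : ℂ) + 1) * ((α : ℂ) + 3) * ((α : ℂ) + 4))) *
      (1 + -x * pFq {1, (α : ℂ) + 3} {(α : ℂ) + 2, (α : ℂ) + 5} (-x)) =
      s / ((α : ℂ) + 1) * (((α : ℂ) + 2) / (((α : ℂ) + 3) * ((α : ℂ) + 4)) *
        (1 + -x * pFq {1, (α : ℂ) + 3} {(α : ℂ) + 2, (α : ℂ) + 5} (-x))) by field_simp, ← hc]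
  push_cast
  field_simp
  ring

/-! ### Termination for nonnegative integers α -/

theorem ringChoose_eq_zero {c : ℝ} {q k : ℕ} (hc : c = q) (h : q < k) : Ring.choose c k = 0 := by
  rw [ringChoose_eq_poch, hc, poch_neg_natCast_eq_zero q k h, zero_div, mul_zero]

theorem ringChoose_mul_ringChoose_eq_zero {A B : ℝ} {p q n k : ℕ} (hA : A = p) (hB : B = q)
    (h : p + q < n + k) : Ring.choose A n * Ring.choose B k = 0 := by
  rcases lt_or_ge p n with h1 | h1
  · rw [ringChoose_eq_zero hA h1, zero_mul]
  · rw [ringChoose_eq_zero hB (by omega), mul_zero]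

theorem aCoeff_natCast_eq_zero (m i : ℕ) (hi : 2 * m + 4 < i) (x : ℂ) :
    aCoeff (m : ℝ) i x = 0 := by
  rw [aCoeff, Finset.sum_eq_zero, mul_zero]
  intro j hj
  rw [Finset.mem_Icc] at hj
  rw [mul_assoc ((-1 : ℝ) ^ _), ringChoose_mul_ringChoose_eq_zero (p := m + 1) (q := m + 2)
    (by push_cast; ring) (by push_cast; ring) (by omega)]
  simp

/-- The bound is set by the fourth part, whose two binomials both have upper entry `m + 4`. -/
theorem betaCoeff_natCast_eq_zero (m i : ℕ) (hi : 2 * m + 8 < i) (x : ℂ) :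
    betaCoeff (m : ℝ) i x = 0 := by
  have h1 : betaCoeff1 (m : ℝ) i x = 0 := by
    rw [betaCoeff1, Finset.sum_eq_zero, mul_zero]
    intro j hj
    rw [Finset.mem_Icc] at hj
    rw [mul_assoc ((-1 : ℝ) ^ _), ringChoose_mul_ringChoose_eq_zero (p := m + 2) (q := m + 3)
      (by push_cast; ring) (by push_cast; ring) (by omega)]
    simp
  have h2 : betaCoeff2 (m : ℝ) i x = 0 := by
    rw [betaCoeff2, Finset.sum_eq_zero, mul_zero]
    intro j hj
    rw [Finset.mem_Icc] at hj
    rw [mul_assoc ((-1 : ℝ) ^ _), ringChoose_mul_ringChoose_eq_zero (p := m + 1) (q := m + 2)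
      (by push_cast; ring) (by push_cast; ring) (by omega)]
    simp
  have h3 : betaCoeff3 (m : ℝ) i x = 0 := by
    rw [betaCoeff3, Finset.sum_eq_zero, mul_zero]
    intro j hj
    rw [Finset.mem_Icc] at hj
    rw [mul_assoc ((-1 : ℝ) ^ _), ringChoose_mul_ringChoose_eq_zero (p := m + 3) (q := m + 3)
      (by push_cast; ring) (by push_cast; ring) (by omega)]
    simp
  have h4 : betaCoeff4 (m : ℝ) i x = 0 := by
    rw [betaCoeff4, Finset.sum_eq_zero, mul_zero]
    intro j hj
    rw [Finset.mem_Icc] at hj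
    rw [mul_assoc ((-1 : ℝ) ^ _), ringChoose_mul_ringChoose_eq_zero (p := m + 4) (q := m + 4)
      (by push_cast; ring) (by push_cast; ring) (by omega)]
    simp
  rw [betaCoeff, if_neg (by omega), h1, h2, h3, h4]
  simp

theorem sum_Icc_eq_of_hasSum {f : ℕ → ℂ} {S : ℂ} (hf : HasSum (fun i => f (i + 1)) S) (N : ℕ)
    (h : ∀ i, N < i → f i = 0) : ∑ i ∈ Finset.Icc 1 N, f i = S := by
  have h1 : HasSum (fun i => f (i + 1)) (∑ i ∈ Finset.range N, f (i + 1)) :=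
    hasSum_sum_of_ne_finset_zero fun i hi => h _ (by rw [Finset.mem_range] at hi; omega)
  rw [hf.unique h1, Finset.range_eq_Ico, Finset.sum_Ico_add' f 0 N 1, zero_add]
  rfl

end SobolevLaguerre

theorem mainTheorem3 (α : ℝ) (hα : -1 < α) (x : ℂ) :
    (Summable (fun i : ℕ => ‖SobolevLaguerre.aCoeff α (i + 1) x‖) ∧
      HasSum (fun i : ℕ => SobolevLaguerre.aCoeff α (i + 1) x)
        (-((Real.sin (Real.pi * α) / Real.pi : ℝ) : ℂ) *
          (x / (((α : ℂ) + 2) * ((α : ℂ) + 3))) *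
          SobolevLaguerre.pFq {1} {(α : ℂ) + 4} (-x))) ∧
    (Summable (fun i : ℕ => ‖SobolevLaguerre.betaCoeff α (i + 1) x‖) ∧
      HasSum (fun i : ℕ => SobolevLaguerre.betaCoeff α (i + 1) x)
        (((Real.sin (Real.pi * α) / Real.pi : ℝ) : ℂ) *
          (((α : ℂ) + 2) / (((α : ℂ) + 1) * ((α : ℂ) + 3) * ((α : ℂ) + 4))) *
          (1 - x * SobolevLaguerre.pFq {1, (α : ℂ) + 3} {(α : ℂ) + 2, (α : ℂ) + 5} (-x)))) ∧
    (∀ m : ℕ, α = (m : ℝ) →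
      HasSum (fun i : ℕ => SobolevLaguerre.aCoeff α (i + 1) x) 0 ∧
      HasSum (fun i : ℕ => SobolevLaguerre.betaCoeff α (i + 1) x) 0 ∧
      ∑ i ∈ Finset.Icc 1 (2 * m + 4), SobolevLaguerre.aCoeff α i x = 0 ∧
      ∑ i ∈ Finset.Icc 1 (2 * m + 8), SobolevLaguerre.betaCoeff α i x = 0) := by
  have ha := SobolevLaguerre.hasSum_aCoeff hα x
  have hb := SobolevLaguerre.hasSum_betaCoeff hα x
  refine ⟨⟨SobolevLaguerre.summable_norm_aCoeff α x, ha⟩,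
    ⟨SobolevLaguerre.summable_norm_betaCoeff α x, hb⟩, ?_⟩
  rintro m rfl
  have hs : Real.sin (Real.pi * m) / Real.pi = 0 := by
    rw [mul_comm, Real.sin_nat_mul_pi, zero_div]
  rw [hs, Complex.ofReal_zero, neg_zero, zero_mul, zero_mul] at ha
  rw [hs, Complex.ofReal_zero, zero_mul, zero_mul] at hb
  have ha' := SobolevLaguerre.sum_Icc_eq_of_hasSum (f := fun i => SobolevLaguerre.aCoeff m i x) ha
    (2 * m + 4) fun i hi => SobolevLaguerre.aCoeff_natCast_eq_zero m i hi x
  have hb' := SobolevLaguerre.sum_Icc_eq_of_hasSum (f := fun i => SobolevLaguerre.betaCoeff m i x)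
    hb (2 * m + 8) fun i hi => SobolevLaguerre.betaCoeff_natCast_eq_zero m i hi x
  exact ⟨ha, hb, ha', hb'⟩
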